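/- Let $R$ be a (not necessarily commutative) local ring with identity and Jacobson radical $J=J(R)$, and suppose that $R$ is separated and complete for the $J$-adic topology. Let $\sigma$ be an automorphism of the ring $R$ (so that $\sigma(J)\subseteq J$), and let $\delta:R\to R$ be a $\sigma$-derivation, i.e. an additive map with $\delta(ab)=\sigma(a)\delta(b)+\delta(a)b$ for all $a,b\in R$, such that $\delta(R)\subseteq J$ and $\delta(J)\subseteq J^{2}$. Suppose that $\delta$ is $\sigma$-nilpotent: for every $n\ge 1$ there is $m\ge 1$ such that every composition $M$ of copies of $\delta$ and $\sigma$ (in any order) with at least $m$ factors $\delta$ satisfies $M(R)\subseteq J^{n}$. Let $S=R[[x;\sigma,\delta]]$ be the skew power series ring: its elements are the formal series $\sum_{i\ge 0}a_ix^i$ with $a_i\in R$, with coefficientwise addition and the multiplication $$\Big(\sum_{j\ge 0}a_jx^j\Big)\Big(\sum_{l\ge 0}b_lx^l\Big)=\sum_{m\ge 0}\Big(\sum_{n=0}^{m}\sum_{j\ge n}a_j\,M_{j-n,n}(\delta,\sigma)(b_{m-n})\Big)x^m ,$$ where $M_{k,l}(\delta,\sigma)$ is the sum of all noncommutative monomials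 in $\delta$ and $\sigma$ with $k$ factors $\delta$ and $l$ factors $\sigma$, and the inner sums converge $J$-adically. Let $\mathrm{Gr}_{J}R=\bigoplus_{n\ge 0}J^{n}/J^{n+1}$ be the associated graded ring of $R$. If $\mathrm{Gr}_{J}R$ is left Noetherian, then $S$ is left Noetherian; and if $\mathrm{Gr}_{J}R$ is right Noetherian, then $S$ is right Noetherian. In particular, if $\mathrm{Gr}_{J}R$ is Noetherian (on both sides), then so is $S$. -/

import Mathlib

namespace SkewSeries

universe u

section Basic

variable {R : Type u} [Ring R]

/-- `δ` is a `σ`-derivation: an additive map with `δ(ab) = σ(a)δ(b) + δ(a)b`. -/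
def IsSkewDerivation (σ : R →+* R) (δ : R →+ R) : Prop :=
  ∀ a b : R, δ (a * b) = σ a * δ b + δ a * b

/-- Separated and complete for the `I`-adic topology, i.e. `R → lim R / I ^ n` is bijective. -/
structure IsAdicallyComplete (I : Ideal R) : Prop where
  separated : ∀ r : R, (∀ n : ℕ, r ∈ I ^ n) → r = 0
  complete : ∀ u : ℕ → R, (∀ m n : ℕ, m ≤ n → u n - u m ∈ I ^ m) →
    ∃ s : R, ∀ n : ℕ, u n - s ∈ I ^ n

/-- The series `∑ uᵢ` converges to `s` in the `I`-adic topology. -/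
def HasAdicSum (I : Ideal R) (u : ℕ → R) (s : R) : Prop :=
  ∀ n : ℕ, ∃ N : ℕ, ∀ j : ℕ, N ≤ j → (∑ i ∈ Finset.range j, u i) - s ∈ I ^ n

open Classical in
/-- The `I`-adic sum of a series (zero if the series does not converge). -/
noncomputable def adicSum (I : Ideal R) (u : ℕ → R) : R :=
  if h : ∃ s, HasAdicSum I u s then h.choose else 0

/-- The value `M(δ, σ)` of a noncommutative monomial `M` in two letters, evaluated by composition.
The letter `true` is replaced by `δ` and the letter `false` by `σ`. -/
def wordMap (σ : R →+* R) (δ : R →+ R) : List Bool → R →+ R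
  | [] => AddMonoidHom.id R
  | true :: w => δ.comp (wordMap σ δ w)
  | false :: w => (σ : R →+ R).comp (wordMap σ δ w)

/-- The finite set of all monomials with exactly `k` letters `true` and `l` letters `false`. -/
def monomials (k l : ℕ) : Finset (List Bool) :=
  (List.replicate k true ++ List.replicate l false).permutations.toFinset

/-- `M_{k,l}(δ, σ)`: the sum of all noncommutative monomials in `δ` and `σ` with `k` factors `δ` and
`l` factors `σ`. -/
def monomialSum (σ : R →+* R) (δ : R →+ R) (k l : ℕ) : R →+ R :=
  ∑ w ∈ monomials k l, wordMap σ δ w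

/-- `σ`-nilpotency of `δ` with respect to `I`: for every `n ≥ 1` there is `m ≥ 1` such that all
monomials in `δ` and `σ` with at least `m` factors `δ` map `R` into `I ^ n`. -/
def IsSkewNilpotent (I : Ideal R) (σ : R →+* R) (δ : R →+ R) : Prop :=
  ∀ n : ℕ, 1 ≤ n → ∃ m : ℕ, 1 ≤ m ∧
    ∀ w : List Bool, m ≤ w.count true → ∀ r : R, wordMap σ δ w r ∈ I ^ n

/-- The conditions under which the skew power series ring `R[[x; σ, δ]]` is formed. -/
structure IsAdmissible (I : Ideal R) (σ : R →+* R) (δ : R →+ R) : Prop where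
  derivation : IsSkewDerivation σ δ
  complete : IsAdicallyComplete I
  stable : ∀ a ∈ I, σ a ∈ I
  nilpotent : IsSkewNilpotent I σ δ

/-- The underlying set of `R[[x; σ, δ]]`: the function `f` stands for the series `∑ f(i) xⁱ`, with
coefficients on the left. -/
def SkewPowerSeries {I : Ideal R} {σ : R →+* R} {δ : R →+ R} (_h : IsAdmissible I σ δ) : Type u :=
  ℕ → R

/-- The product of two series: the coefficient of `x ^ m` is
`∑_{n ≤ m} ∑_{j ≥ n} a_j M_{j-n,n}(δ, σ)(b_{m-n})`, with `j = n + k`. -/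
noncomputable def seriesMul (I : Ideal R) (σ : R →+* R) (δ : R →+ R) (a b : ℕ → R) : ℕ → R :=
  fun m => ∑ n ∈ Finset.range (m + 1),
    adicSum I (fun k => a (n + k) * monomialSum σ δ k n (b (m - n)))

/-! ### The product satisfies the ring axioms -/

lemma mem_monomials {k l : ℕ} {w : List Bool} :
    w ∈ monomials k l ↔ w.count true = k ∧ w.count false = l := by
  unfold monomials
  rw [List.mem_toFinset, List.mem_permutations, List.perm_iff_count]
  constructor
  · intro h
    have h1 := h true
    have h2 := h false
    simp [List.count_replicate] at h1 h2
    exact ⟨h1, h2⟩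
  · rintro ⟨h1, h2⟩ (_ | _) <;> simp [List.count_replicate, h1, h2]

lemma monomialSum_zero_zero (σ : R →+* R) (δ : R →+ R) (r : R) : monomialSum σ δ 0 0 r = r := by
  simp [monomialSum, monomials, wordMap]

lemma sum_image_cons (σ : R →+* R) (δ : R →+ R) (b : Bool) (s : Finset (List Bool)) (r : R) :
    ∑ w ∈ s.image (List.cons b), wordMap σ δ w r = ∑ w ∈ s, wordMap σ δ (b :: w) r :=
  Finset.sum_image (fun _ _ _ _ h => by simpa using h)

lemma monomials_succ_zero (k : ℕ) :
    monomials (k + 1) 0 = (monomials k 0).image (List.cons true) := by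
  ext w
  rcases w with _ | ⟨_ | _, w⟩ <;> simp [mem_monomials]

lemma monomials_zero_succ (l : ℕ) :
    monomials 0 (l + 1) = (monomials 0 l).image (List.cons false) := by
  ext w
  rcases w with _ | ⟨_ | _, w⟩ <;> simp [mem_monomials]

lemma monomials_succ_succ (k l : ℕ) :
    monomials (k + 1) (l + 1) = (monomials k (l + 1)).image (List.cons true) ∪
      (monomials (k + 1) l).image (List.cons false) := by
  ext w
  rcases w with _ | ⟨_ | _, w⟩ <;> simp [mem_monomials]

lemma monomialSum_apply (σ : R →+* R) (δ : R →+ R) (k l : ℕ) (r : R) :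
    monomialSum σ δ k l r = ∑ w ∈ monomials k l, wordMap σ δ w r := by
  simp [monomialSum]

lemma monomialSum_succ_zero (σ : R →+* R) (δ : R →+ R) (k : ℕ) (r : R) :
    monomialSum σ δ (k + 1) 0 r = δ (monomialSum σ δ k 0 r) := by
  simp only [monomialSum_apply, monomials_succ_zero, sum_image_cons, map_sum, wordMap,
    AddMonoidHom.comp_apply]

lemma monomialSum_zero_succ (σ : R →+* R) (δ : R →+ R) (l : ℕ) (r : R) :
    monomialSum σ δ 0 (l + 1) r = σ (monomialSum σ δ 0 l r) := by
  simp only [monomialSum_apply, monomials_zero_succ, sum_image_cons, map_sum, wordMap,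
    AddMonoidHom.comp_apply, AddMonoidHom.coe_coe]

lemma monomialSum_succ_succ (σ : R →+* R) (δ : R →+ R) (k l : ℕ) (r : R) :
    monomialSum σ δ (k + 1) (l + 1) r =
      δ (monomialSum σ δ k (l + 1) r) + σ (monomialSum σ δ (k + 1) l r) := by
  have hd : Disjoint ((monomials k (l + 1)).image (List.cons true))
      ((monomials (k + 1) l).image (List.cons false)) := by
    rw [Finset.disjoint_left]
    intro w h1 h2
    simp only [Finset.mem_image] at h1 h2
    obtain ⟨_, _, rfl⟩ := h1
    obtain ⟨_, _, h⟩ := h2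
    simp at h
  simp only [monomialSum_apply, monomials_succ_succ, Finset.sum_union hd, sum_image_cons, map_sum,
    wordMap, AddMonoidHom.comp_apply, AddMonoidHom.coe_coe]

/-- Left multiplication by `x` on series, given by `x * (∑ gᵢ xⁱ) = ∑ (σ(gᵢ) xⁱ⁺¹ + δ(gᵢ) xⁱ)`. -/
def mulX (σ : R →+* R) (δ : R →+ R) (g : ℕ → R) : ℕ → R
  | 0 => δ (g 0)
  | m + 1 => σ (g m) + δ (g (m + 1))

lemma mulX_iterate (σ : R →+* R) (δ : R →+ R) (g : ℕ → R) (j m : ℕ) :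
    (mulX σ δ)^[j] g m = ∑ n ∈ Finset.range (m + 1),
      if n ≤ j then monomialSum σ δ (j - n) n (g (m - n)) else 0 := by
  induction j generalizing m with
  | zero =>
    rw [Finset.sum_eq_single 0]
    · simp [monomialSum_zero_zero]
    · intro b _ hb
      simp [hb]
    · simp
  | succ j ih =>
    rw [Function.iterate_succ_apply']
    cases m with
    | zero =>
      simp [mulX, ih, monomialSum_succ_zero]
    | succ m =>
      simp only [mulX]
      rw [ih m, ih (m + 1), Finset.sum_range_succ' _ (m + 1), Finset.sum_range_succ' _ (m + 1)]
      simp only [map_add, map_sum]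
      rw [← add_assoc, ← Finset.sum_add_distrib]
      congr 1
      · refine Finset.sum_congr rfl fun n _ => ?_
        rcases lt_trichotomy n j with h | h | h
        · obtain ⟨k, rfl⟩ : ∃ k, j = n + 1 + k := ⟨j - (n + 1), by omega⟩
          have e1 : n + 1 + k - n = k + 1 := by omega
          have e2 : n + 1 + k - (n + 1) = k := by omega
          have e3 : n + 1 + k + 1 - (n + 1) = k + 1 := by omega
          have e4 : m + 1 - (n + 1) = m - n := by omega
          rw [if_pos (by omega), if_pos (by omega), if_pos (by omega), e1, e2, e3, e4,
            monomialSum_succ_succ, add_comm]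
        · subst h
          have e4 : m + 1 - (n + 1) = m - n := by omega
          simp [monomialSum_zero_succ]
        · simp [show ¬ n ≤ j by omega, show ¬ n + 1 ≤ j by omega]
      · simp [monomialSum_succ_zero]

end Basic

section Product

variable {R : Type u} [Ring R] {I : Ideal R} {σ : R →+* R} {δ : R →+ R}

lemma mem_pow_zero (I : Ideal R) (r : R) : r ∈ I ^ 0 := by
  rw [Submodule.pow_zero, Ideal.one_eq_top]
  trivial

/-- A series with tails in the powers of `I` converges. -/
lemma hasAdicSum_adicSum (hI : IsAdicallyComplete I) {u : ℕ → R}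
    (hu : ∀ n : ℕ, ∃ N : ℕ, ∀ j, N ≤ j → u j ∈ I ^ n) : HasAdicSum I u (adicSum I u) := by
  have key : ∃ s, HasAdicSum I u s := by
    choose N hN using hu
    let N' : ℕ → ℕ := fun n => ∑ i ∈ Finset.range (n + 1), N i
    have hmono : Monotone N' := by
      intro a b hab
      exact Finset.sum_le_sum_of_subset (by
        intro i hi
        simp only [Finset.mem_range] at hi ⊢
        omega)
    have hle : ∀ n, N n ≤ N' n := fun n =>
      Finset.single_le_sum (f := N) (fun _ _ => Nat.zero_le _) (Finset.self_mem_range_succ n)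
    have hdiff : ∀ n a b, N' n ≤ a → a ≤ b →
        (∑ i ∈ Finset.range b, u i) - (∑ i ∈ Finset.range a, u i) ∈ I ^ n := by
      intro n a b ha hab
      rw [← Finset.sum_Ico_eq_sub _ hab]
      refine Submodule.sum_mem _ fun i hi => hN n i ?_
      rw [Finset.mem_Ico] at hi
      have := hle n
      omega
    obtain ⟨s, hs⟩ := hI.complete (fun n => ∑ i ∈ Finset.range (N' n), u i)
      (fun m n hmn => hdiff m _ _ le_rfl (hmono hmn))
    refine ⟨s, fun n => ⟨N' n, fun j hj => ?_⟩⟩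
    have := Submodule.add_mem _ (hdiff n _ j le_rfl hj) (hs n)
    simpa using this
  unfold adicSum
  rw [dif_pos key]
  exact key.choose_spec

lemma monomialSum_mem (h : IsAdmissible I σ δ) (n : ℕ) :
    ∃ m : ℕ, ∀ k l, m ≤ k → ∀ r, monomialSum σ δ k l r ∈ I ^ n := by
  rcases Nat.eq_zero_or_pos n with rfl | hn
  · exact ⟨0, fun k l _ r => mem_pow_zero I _⟩
  obtain ⟨m, -, hm⟩ := h.nilpotent n hn
  refine ⟨m, fun k l hk r => ?_⟩
  rw [monomialSum_apply]
  refine Submodule.sum_mem _ fun w hw => hm w ?_ r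
  rw [(mem_monomials.1 hw).1]
  exact hk

lemma map_pow_mem (h : IsAdmissible I σ δ) (n : ℕ) : ∀ a ∈ I ^ n, σ a ∈ I ^ n := by
  induction n with
  | zero => exact fun a _ => mem_pow_zero I _
  | succ n ih =>
    intro a ha
    rw [Submodule.pow_succ] at ha ⊢
    refine Submodule.mul_induction_on ha (fun x hx y hy => ?_) (fun x y hx hy => ?_)
    · rw [map_mul]
      exact Ideal.mul_mem_mul (ih x hx) (h.stable y hy)
    · rw [map_add]
      exact add_mem hx hy

lemma derivation_pow_mem [I.IsTwoSided] (h : IsAdmissible I σ δ) (n : ℕ) : ∀ a ∈ I ^ (n + 1), δ a ∈ I ^ n := by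
  induction n with
  | zero => exact fun a _ => mem_pow_zero I _
  | succ n ih =>
    intro a ha
    rw [Submodule.pow_succ] at ha
    refine Submodule.mul_induction_on ha (fun x hx y hy => ?_) (fun x y hx hy => ?_)
    · rw [h.derivation]
      refine add_mem ?_ ?_
      · exact Ideal.mul_mem_right _ _ (map_pow_mem h _ x hx)
      · rw [Submodule.pow_succ]
        exact Ideal.mul_mem_mul (ih x hx) hy
    · rw [map_add]
      exact add_mem hx hy

lemma mulX_iterate_mem (h : IsAdmissible I σ δ) (n m : ℕ) :
    ∃ N : ℕ, ∀ j, N ≤ j → ∀ g : ℕ → R, (mulX σ δ)^[j] g m ∈ I ^ n := by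
  obtain ⟨M, hM⟩ := monomialSum_mem h n
  refine ⟨M + m, fun j hj g => ?_⟩
  rw [mulX_iterate]
  refine Submodule.sum_mem _ fun i hi => ?_
  rw [Finset.mem_range] at hi
  rw [if_pos (by omega)]
  exact hM _ _ (by omega) _

/-- The product is the sum of the series `∑ aⱼ xʲ b`. -/
lemma hasAdicSum_seriesMul (h : IsAdmissible I σ δ) (a b : ℕ → R) (m : ℕ) :
    HasAdicSum I (fun j => a j * (mulX σ δ)^[j] b m) (seriesMul I σ δ a b m) := by
  intro n
  have h1 : ∀ i, HasAdicSum I (fun k => a (i + k) * monomialSum σ δ k i (b (m - i)))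
      (adicSum I (fun k => a (i + k) * monomialSum σ δ k i (b (m - i)))) := by
    intro i
    refine hasAdicSum_adicSum h.complete fun n => ?_
    obtain ⟨M, hM⟩ := monomialSum_mem h n
    exact ⟨M, fun k hk => Ideal.mul_mem_left _ _ (hM k i hk _)⟩
  choose N hN using fun i => h1 i n
  refine ⟨∑ i ∈ Finset.range (m + 1), (N i + i), fun j hj => ?_⟩
  have h2 : ∑ i ∈ Finset.range j, a i * (mulX σ δ)^[i] b m =
      ∑ n ∈ Finset.range (m + 1), ∑ k ∈ Finset.range (j - n),
        a (n + k) * monomialSum σ δ k n (b (m - n)) := by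
    simp only [mulX_iterate, Finset.mul_sum]
    rw [Finset.sum_comm]
    refine Finset.sum_congr rfl fun n hn => ?_
    have hnj : n ≤ j := by
      have := Finset.single_le_sum (f := fun i => N i + i) (fun _ _ => Nat.zero_le _) hn
      omega
    obtain ⟨d, rfl⟩ := Nat.exists_eq_add_of_le hnj
    rw [Finset.sum_range_add, Finset.sum_eq_zero, zero_add]
    · simp
    · intro i hi
      rw [Finset.mem_range] at hi
      simp [show ¬ n ≤ i by omega]
  rw [h2]
  unfold seriesMul
  rw [← Finset.sum_sub_distrib]
  refine Submodule.sum_mem _ fun i hi => hN i _ ?_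
  have := Finset.single_le_sum (f := fun i => N i + i) (fun _ _ => Nat.zero_le _) hi
  omega

/-- Modulo `I ^ n`, a coefficient of a product is a finite sum of uniformly bounded length. -/
lemma seriesMul_approx (h : IsAdmissible I σ δ) (n m : ℕ) :
    ∃ N : ℕ, (∀ j, N ≤ j → ∀ g : ℕ → R, (mulX σ δ)^[j] g m ∈ I ^ n) ∧
      ∀ j, N ≤ j → ∀ a b : ℕ → R,
      seriesMul I σ δ a b m - ∑ i ∈ Finset.range j, a i * (mulX σ δ)^[i] b m ∈ I ^ n := by
  obtain ⟨N, hN⟩ := mulX_iterate_mem h n m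
  refine ⟨N, hN, fun j hj a b => ?_⟩
  obtain ⟨N', hN'⟩ := hasAdicSum_seriesMul h a b m n
  have h1 := hN' (max N' j) (le_max_left _ _)
  have h2 : (∑ i ∈ Finset.range (max N' j), a i * (mulX σ δ)^[i] b m) -
      ∑ i ∈ Finset.range j, a i * (mulX σ δ)^[i] b m ∈ I ^ n := by
    rw [← Finset.sum_Ico_eq_sub _ (le_max_right _ _)]
    refine Submodule.sum_mem _ fun i hi => Ideal.mul_mem_left _ _ (hN i ?_ b)
    rw [Finset.mem_Ico] at hi
    omega
  have := Submodule.sub_mem _ h2 h1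
  simpa using this

lemma eq_of_sub_mem (h : IsAdmissible I σ δ) {r s : R} (hrs : ∀ n : ℕ, r - s ∈ I ^ n) : r = s :=
  sub_eq_zero.1 (h.complete.separated _ hrs)

lemma mulX_add (a b : ℕ → R) : mulX σ δ (a + b) = mulX σ δ a + mulX σ δ b := by
  funext m
  cases m with
  | zero => simp [mulX]
  | succ m => simp [mulX]; abel

lemma mulX_iterate_add (j : ℕ) (a b : ℕ → R) :
    (mulX σ δ)^[j] (a + b) = (mulX σ δ)^[j] a + (mulX σ δ)^[j] b := by
  induction j with
  | zero => rfl
  | succ j ih => simp only [Function.iterate_succ_apply', ih, mulX_add]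

lemma seriesMul_add (h : IsAdmissible I σ δ) (a b c : ℕ → R) :
    seriesMul I σ δ a (b + c) = seriesMul I σ δ a b + seriesMul I σ δ a c := by
  funext m
  refine eq_of_sub_mem h fun n => ?_
  obtain ⟨N, -, hN⟩ := seriesMul_approx h n m
  have h1 := hN N le_rfl a (b + c)
  have h2 := hN N le_rfl a b
  have h3 := hN N le_rfl a c
  have := Submodule.sub_mem _ h1 (Submodule.add_mem _ h2 h3)
  simp only [mulX_iterate_add, Pi.add_apply, mul_add, Finset.sum_add_distrib] at this ⊢
  convert this using 1
  abel

lemma add_seriesMul (h : IsAdmissible I σ δ) (a b c : ℕ → R) :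
    seriesMul I σ δ (a + b) c = seriesMul I σ δ a c + seriesMul I σ δ b c := by
  funext m
  refine eq_of_sub_mem h fun n => ?_
  obtain ⟨N, -, hN⟩ := seriesMul_approx h n m
  have h1 := hN N le_rfl (a + b) c
  have h2 := hN N le_rfl a c
  have h3 := hN N le_rfl b c
  have := Submodule.sub_mem _ h1 (Submodule.add_mem _ h2 h3)
  simp only [Pi.add_apply, add_mul, Finset.sum_add_distrib] at this ⊢
  convert this using 1
  abel

lemma mulX_single (h : IsAdmissible I σ δ) (i : ℕ) :
    mulX σ δ (Pi.single i 1) = Pi.single (i + 1) 1 := by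
  have hδ : δ 1 = 0 := by
    have := h.derivation 1 1
    simpa using this
  funext m
  cases m with
  | zero =>
    rcases Nat.eq_zero_or_pos i with rfl | hi
    · simp [mulX, hδ]
    · simp [mulX, hi.ne]
  | succ m =>
    simp only [mulX, Pi.single_apply, Nat.add_right_cancel_iff]
    split_ifs <;> simp [hδ]

lemma mulX_iterate_one (h : IsAdmissible I σ δ) (j : ℕ) :
    (mulX σ δ)^[j] (Pi.single 0 1) = Pi.single j 1 := by
  induction j with
  | zero => rfl
  | succ j ih => rw [Function.iterate_succ_apply', ih, mulX_single h]

lemma seriesMul_one (h : IsAdmissible I σ δ) (a : ℕ → R) :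
    seriesMul I σ δ a (Pi.single 0 1) = a := by
  funext m
  refine eq_of_sub_mem h fun n => ?_
  obtain ⟨N, -, hN⟩ := seriesMul_approx h n m
  have := hN (max N (m + 1)) (le_max_left _ _) a (Pi.single 0 1)
  simp only [mulX_iterate_one h, Pi.single_apply, mul_ite, mul_one, mul_zero] at this
  rw [Finset.sum_ite_eq, if_pos (by simp)] at this
  exact this

lemma one_seriesMul (h : IsAdmissible I σ δ) (b : ℕ → R) :
    seriesMul I σ δ (Pi.single 0 1) b = b := by
  funext m
  refine eq_of_sub_mem h fun n => ?_
  obtain ⟨N, -, hN⟩ := seriesMul_approx h n m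
  have := hN (N + 1) (Nat.le_succ _) (Pi.single 0 1) b
  simpa [Pi.single_apply] using this

lemma mulX_sub_mem [I.IsTwoSided] (h : IsAdmissible I σ δ) {n m : ℕ} {f g : ℕ → R}
    (h1 : f m - g m ∈ I ^ (n + 1)) (h2 : f (m - 1) - g (m - 1) ∈ I ^ n) :
    mulX σ δ f m - mulX σ δ g m ∈ I ^ n := by
  have A := derivation_pow_mem h n _ h1
  rw [map_sub] at A
  cases m with
  | zero => exact A
  | succ m =>
    have B := map_pow_mem h n _ h2
    rw [map_sub] at B
    convert Submodule.add_mem _ B A using 1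
    simp only [mulX, Nat.add_sub_cancel]
    abel

lemma mulX_smul (h : IsAdmissible I σ δ) (r : R) (g : ℕ → R) (m : ℕ) :
    mulX σ δ (fun i => r * g i) m = σ r * mulX σ δ g m + δ r * g m := by
  cases m with
  | zero => simp only [mulX, h.derivation (a := r)]
  | succ m =>
    simp only [mulX, h.derivation (a := r), map_mul]
    noncomm_ring

lemma mulX_sum (N : ℕ) (f : ℕ → ℕ → R) (m : ℕ) :
    mulX σ δ (fun k => ∑ i ∈ Finset.range N, f i k) m =
      ∑ i ∈ Finset.range N, mulX σ δ (f i) m := by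
  cases m with
  | zero => simp [mulX]
  | succ m => simp [mulX, Finset.sum_add_distrib]

lemma mulX_seriesMul [I.IsTwoSided] (h : IsAdmissible I σ δ) (b c : ℕ → R) :
    mulX σ δ (seriesMul I σ δ b c) = seriesMul I σ δ (mulX σ δ b) c := by
  funext m
  refine eq_of_sub_mem h fun n => ?_
  obtain ⟨N₁, hz, h₁⟩ := seriesMul_approx h n m
  obtain ⟨N₂, -, h₂⟩ := seriesMul_approx h (n + 1) m
  obtain ⟨N₃, -, h₃⟩ := seriesMul_approx h n (m - 1)
  obtain ⟨N, hN₁, hN₂, hN₃⟩ : ∃ N, N₁ ≤ N ∧ N₂ ≤ N ∧ N₃ ≤ N :=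
    ⟨N₁ + N₂ + N₃, by omega, by omega, by omega⟩
  have A := mulX_sub_mem h (f := seriesMul I σ δ b c)
    (g := fun k => ∑ i ∈ Finset.range N, b i * (mulX σ δ)^[i] c k)
    (h₂ N hN₂ b c) (h₃ N hN₃ b c)
  have B := h₁ (N + 1) (by omega) (mulX σ δ b) c
  have Z : δ (b N) * (mulX σ δ)^[N] c m ∈ I ^ n := Ideal.mul_mem_left _ _ (hz N hN₁ c)
  have hsum : ∑ i ∈ Finset.range (N + 1), mulX σ δ b i * (mulX σ δ)^[i] c m =
      mulX σ δ (fun k => ∑ i ∈ Finset.range N, b i * (mulX σ δ)^[i] c k) m +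
        δ (b N) * (mulX σ δ)^[N] c m := by
    rw [mulX_sum]
    have e : ∀ i, mulX σ δ ((mulX σ δ)^[i] c) m = (mulX σ δ)^[i + 1] c m := fun i => by
      rw [Function.iterate_succ_apply']
    have e' : ∀ i, mulX σ δ (fun k => b i * (mulX σ δ)^[i] c k) m =
        σ (b i) * (mulX σ δ)^[i + 1] c m + δ (b i) * (mulX σ δ)^[i] c m := fun i => by
      rw [mulX_smul h, e]
    simp only [e', Finset.sum_add_distrib]
    rw [add_assoc, ← Finset.sum_range_succ (fun i => δ (b i) * (mulX σ δ)^[i] c m),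
      Finset.sum_range_succ', Finset.sum_range_succ' (fun i => δ (b i) * (mulX σ δ)^[i] c m)]
    have e0 : mulX σ δ b 0 = δ (b 0) := rfl
    have e1 : ∀ i, mulX σ δ b (i + 1) = σ (b i) + δ (b (i + 1)) := fun i => rfl
    simp only [e0, e1, add_mul, Finset.sum_add_distrib]
    abel
  rw [hsum] at B
  convert Submodule.sub_mem _ (Submodule.sub_mem _ A B) Z using 1
  abel

lemma mulX_iterate_seriesMul [I.IsTwoSided] (h : IsAdmissible I σ δ) (j : ℕ) (b c : ℕ → R) :
    (mulX σ δ)^[j] (seriesMul I σ δ b c) = seriesMul I σ δ ((mulX σ δ)^[j] b) c := by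
  induction j with
  | zero => rfl
  | succ j ih => simp only [Function.iterate_succ_apply', ih, mulX_seriesMul h]

lemma seriesMul_assoc [I.IsTwoSided] (h : IsAdmissible I σ δ) (a b c : ℕ → R) :
    seriesMul I σ δ (seriesMul I σ δ a b) c = seriesMul I σ δ a (seriesMul I σ δ b c) := by
  funext m
  refine eq_of_sub_mem h fun n => ?_
  obtain ⟨N, -, hN⟩ := seriesMul_approx h n m
  choose K _ hK using fun i => seriesMul_approx h n i
  set N' := N + ∑ i ∈ Finset.range N, K i with hN'
  have A := hN N le_rfl (seriesMul I σ δ a b) c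
  have B := hN N' (by omega) a (seriesMul I σ δ b c)
  have C : ∀ i ∈ Finset.range N, (seriesMul I σ δ a b i -
      ∑ j ∈ Finset.range N', a j * (mulX σ δ)^[j] b i) * (mulX σ δ)^[i] c m ∈ I ^ n := by
    intro i hi
    have := Finset.single_le_sum (f := K) (fun _ _ => Nat.zero_le _) hi
    exact Ideal.mul_mem_right _ _ (hK i N' (by omega) a b)
  have D : ∀ j ∈ Finset.range N', a j * (seriesMul I σ δ ((mulX σ δ)^[j] b) c m -
      ∑ i ∈ Finset.range N, (mulX σ δ)^[j] b i * (mulX σ δ)^[i] c m) ∈ I ^ n :=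
    fun j _ => Ideal.mul_mem_left _ _ (hN N le_rfl _ c)
  have C' := Submodule.sum_mem _ C
  have D' := Submodule.sum_mem _ D
  simp only [sub_mul, mul_sub, Finset.sum_sub_distrib, Finset.sum_mul, Finset.mul_sum] at C' D'
  rw [Finset.sum_comm] at C'
  simp only [mulX_iterate_seriesMul h] at B
  simp only [← mul_assoc] at D'
  convert Submodule.sub_mem _ (Submodule.add_mem _ A C') (Submodule.add_mem _ B D') using 1
  abel

namespace SkewPowerSeries

instance (h : IsAdmissible I σ δ) : AddCommGroup (SkewPowerSeries h) :=
  inferInstanceAs (AddCommGroup (ℕ → R))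

noncomputable instance (h : IsAdmissible I σ δ) : Mul (SkewPowerSeries h) :=
  ⟨seriesMul I σ δ⟩

instance (h : IsAdmissible I σ δ) : One (SkewPowerSeries h) :=
  ⟨(Pi.single 0 1 : ℕ → R)⟩

/-- The ring `R[[x; σ, δ]]`: addition is coefficientwise and multiplication is `seriesMul`. -/
noncomputable instance [I.IsTwoSided] (h : IsAdmissible I σ δ) : Ring (SkewPowerSeries h) where
  __ := (inferInstance : AddCommGroup (SkewPowerSeries h))
  left_distrib := seriesMul_add h
  right_distrib := add_seriesMul h
  zero_mul a := by
    have := add_seriesMul h 0 0 a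
    rw [add_zero] at this
    exact left_eq_add.1 this
  mul_zero a := by
    have := seriesMul_add h a 0 0
    rw [add_zero] at this
    exact left_eq_add.1 this
  mul_assoc := seriesMul_assoc h
  one_mul := one_seriesMul h
  mul_one := seriesMul_one h

end SkewPowerSeries

end Product

section Graded

variable {R : Type u} [Ring R] (I : Ideal R)

/-- The component `I ^ n / I ^ (n + 1)` of the associated graded ring. -/
abbrev GradedPiece (n : ℕ) : Type u :=
  ↥(I ^ n) ⧸ Submodule.comap (I ^ n).subtype (I ^ (n + 1))

variable {I}

/-- The class in `I ^ n / I ^ (n + 1)` of an element of `I ^ n`. -/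
abbrev GradedPiece.mk {n : ℕ} (a : ↥(I ^ n)) : GradedPiece I n := Submodule.Quotient.mk a

lemma GradedPiece.mk_eq_mk {n : ℕ} {a b : ↥(I ^ n)} :
    GradedPiece.mk a = GradedPiece.mk b ↔ (a : R) - b ∈ I ^ (n + 1) := by
  rw [Submodule.Quotient.eq]
  rfl

lemma GradedPiece.sigma_ext {m n : ℕ} (hmn : m = n) {a : ↥(I ^ m)} {b : ↥(I ^ n)}
    (hab : (a : R) = b) :
    (⟨m, GradedPiece.mk a⟩ : GradedMonoid (GradedPiece I)) = ⟨n, GradedPiece.mk b⟩ := by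
  subst hmn
  rw [Subtype.ext hab]

variable [I.IsTwoSided]

lemma mul_mem_pow_add {m n : ℕ} {a b : R} (ha : a ∈ I ^ m) (hb : b ∈ I ^ n) :
    a * b ∈ I ^ (m + n) := by
  rw [Ideal.IsTwoSided.pow_add]
  exact Ideal.mul_mem_mul ha hb

/-- The product `(a + I ^ (m + 1)) * (b + I ^ (n + 1)) = ab + I ^ (m + n + 1)`. -/
def GradedPiece.mul {m n : ℕ} : GradedPiece I m → GradedPiece I n → GradedPiece I (m + n) :=
  Quotient.map₂ (fun a b => ⟨(a : R) * b, mul_mem_pow_add a.2 b.2⟩) (by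
    intro a a' haa b b' hbb
    have h1 : (a : R) - a' ∈ I ^ (m + 1) := GradedPiece.mk_eq_mk.1 (Quotient.sound haa)
    have h2 : (b : R) - b' ∈ I ^ (n + 1) := GradedPiece.mk_eq_mk.1 (Quotient.sound hbb)
    refine Quotient.exact (GradedPiece.mk_eq_mk.2 ?_)
    have e : (a : R) * b - a' * b' = (a - a') * b + a' * (b - b') := by noncomm_ring
    have A := mul_mem_pow_add h1 b.2
    have B := mul_mem_pow_add a'.2 h2
    rw [show m + 1 + n = m + n + 1 by omega] at A
    simp only [e]
    exact add_mem A B)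

lemma GradedPiece.mul_mk {m n : ℕ} (a : ↥(I ^ m)) (b : ↥(I ^ n)) :
    GradedPiece.mul (GradedPiece.mk a) (GradedPiece.mk b) =
      GradedPiece.mk ⟨(a : R) * b, mul_mem_pow_add a.2 b.2⟩ := rfl

instance : GradedMonoid.GMul (GradedPiece I) := ⟨GradedPiece.mul⟩

instance : GradedMonoid.GOne (GradedPiece I) := ⟨GradedPiece.mk ⟨1, mem_pow_zero I 1⟩⟩

instance : DirectSum.GRing (GradedPiece I) where
  mul_zero := by
    rintro i j ⟨a⟩
    refine GradedPiece.mk_eq_mk.2 ?_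
    simp
  zero_mul := by
    rintro i j ⟨a⟩
    refine GradedPiece.mk_eq_mk.2 ?_
    simp
  mul_add := by
    rintro i j ⟨a⟩ ⟨b⟩ ⟨c⟩
    refine GradedPiece.mk_eq_mk.2 ?_
    simp [mul_add]
  add_mul := by
    rintro i j ⟨a⟩ ⟨b⟩ ⟨c⟩
    refine GradedPiece.mk_eq_mk.2 ?_
    simp [add_mul]
  one_mul := by
    rintro ⟨n, ⟨a⟩⟩
    exact GradedPiece.sigma_ext (zero_add n) (one_mul _)
  mul_one := by
    rintro ⟨n, ⟨a⟩⟩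
    exact GradedPiece.sigma_ext (add_zero n) (mul_one _)
  mul_assoc := by
    rintro ⟨m, ⟨a⟩⟩ ⟨n, ⟨b⟩⟩ ⟨k, ⟨c⟩⟩
    exact GradedPiece.sigma_ext (add_assoc m n k) (mul_assoc _ _ _)
  natCast n := GradedPiece.mk ⟨n, mem_pow_zero I _⟩
  natCast_zero := by
    refine GradedPiece.mk_eq_mk.2 ?_
    simp
  natCast_succ n := by
    refine GradedPiece.mk_eq_mk.2 ?_
    simp
  intCast n := GradedPiece.mk ⟨n, mem_pow_zero I _⟩
  intCast_ofNat n := by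
    refine GradedPiece.mk_eq_mk.2 ?_
    simp
  intCast_negSucc_ofNat n := by
    refine GradedPiece.mk_eq_mk.2 ?_
    simp

variable (I) in
/-- The associated graded ring `Gr_I R = ⨁ I ^ n / I ^ (n + 1)`. -/
abbrev AssociatedGraded : Type u := DirectSum ℕ (GradedPiece I)

end Graded

end SkewSeries

/-! Give `x` degree one and an element of `I ^ n` degree `n`. Since `δ` maps `I ^ n` into `I ^ (n +
1)`, both terms of `x a = σ(a) x + δ(a)` have degree at least `n + 1`. So the groups
`totalFiltration n` of series with `fⱼ ∈ I ^ (n - j)` form a multiplicative filtration of `S`, which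
is separated and complete because `R` is. The associated graded ring is the skew polynomial ring
over `Gr_I R` with the maps induced by `σ` and `δ`, so Hilbert's basis theorem should apply to it
and its conclusion should lift to `S`.

The proof runs both steps at once on series. Modulo `totalFiltration (n + 1)`, a series in
`totalFiltration n` is a polynomial of `x`-degree at most `n`; `leadSubgroup n i` requires this
degree to be less than `i`, and interpolates between the two filtration steps. Up to higher powers
of `I`, the leading coefficient of a product is `fₗ σˡ(gᵢ)` (`coeff_mul_sub_mem`): the terms from
`δ` have the same total degree but smaller `x`-degree.

For an ideal `L`, the leading coefficients of its members form a family in `Gr_I R` indexed by an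
adic degree `p` and an `x`-degree `d`. Noetherianity gives finitely many members that generate all
others from no larger `p` and `d` (`exists_finset_left_approx`, `exists_finset_right_approx`).
Multiplying these members by suitable monomials cancels leading terms one by one, and completeness
sums the corrections (`le_span_of_refined_approx`). Surjectivity of `σ` on each `I ^ n` serves to
untwist the powers of `σ`. -/

namespace SkewSeries

/-! ### Finite generation in Noetherian and in complete filtered rings -/

/-- In a left Noetherian ring, the left span of a family graded by `ℕ` is generated, compatibly with
the degrees, by finitely many members of the family. -/
lemma exists_finset_mem_span {B ι : Type*} [Ring B] [IsNoetherianRing B] (v : ι → B) (d : ι → ℕ) :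
    ∃ K : Finset ι, ∀ i, v i ∈ Ideal.span (v '' ({k ∈ K | d k ≤ d i} : Finset ι)) := by
  classical
  let A : ℕ →o Ideal B :=
    ⟨fun n => Ideal.span (v '' {k | d k ≤ n}), fun m n hmn =>
      Ideal.span_mono (Set.image_mono fun k (hk : d k ≤ m) => hk.trans hmn)⟩
  have hA : ∀ n, ∃ t : Finset ι, (∀ k ∈ t, d k ≤ n) ∧ A n = Ideal.span (v '' t) := by
    intro n
    obtain ⟨s, hs, hs'⟩ := (Submodule.fg_span_iff_fg_span_finset_subset (R := B)
      (v '' {k | d k ≤ n})).1 (IsNoetherian.noetherian _)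
    obtain ⟨t, ht, rfl⟩ := Finset.subset_set_image_iff.1 hs
    exact ⟨t, fun k hk => ht hk, hs'.trans (by rw [Finset.coe_image])⟩
  choose t ht htA using hA
  obtain ⟨N, hN⟩ := monotone_stabilizes_iff_noetherian.2 (inferInstanceAs (IsNoetherian B B)) A
  refine ⟨(Finset.range (N + 1)).biUnion t, fun i => ?_⟩
  -- The chain is constant from `N` on, so a level that is both at most `N` and at most `d i`
  -- already contains `v i`.
  have hi : v i ∈ A (min N (d i)) := by
    have h1 : v i ∈ A (d i) := Ideal.subset_span ⟨i, le_refl (d i), rfl⟩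
    rcases le_total N (d i) with h | h
    · rw [min_eq_left h, hN _ h]
      exact h1
    · rwa [min_eq_right h]
  rw [htA] at hi
  refine Ideal.span_mono (Set.image_mono fun k hk => ?_) hi
  simp only [Finset.coe_filter, Set.mem_ofPred_eq, Finset.mem_biUnion, Finset.mem_range]
  exact ⟨⟨_, by omega, hk⟩, (ht _ k hk).trans (min_le_right _ _)⟩

/-- In a ring that is separated and complete for a decreasing filtration by right ideals, a left
ideal is generated by a finite family as soon as the family generates it step by step along the
filtration, with coefficients going to zero. -/
lemma le_span_of_approx {A ι : Type*} [Ring A] [Fintype ι] (F : ℕ → AddSubgroup A)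
    (hmul : ∀ n, ∀ a ∈ F n, ∀ b, a * b ∈ F n)
    (hanti : Antitone F) (htop : F 0 = ⊤) (hsep : ∀ a, (∀ n, a ∈ F n) → a = 0)
    (hcomplete : ∀ u : ℕ → A, (∀ n, u (n + 1) - u n ∈ F n) → ∃ s, ∀ n, s - u n ∈ F n)
    (L : Ideal A) (g : ι → A) (hg : ∀ k, g k ∈ L) (c : ℕ)
    (H : ∀ n, ∀ f ∈ L, f ∈ F n →
      ∃ s : ι → A, (∀ k, s k ∈ F (n - c)) ∧ f - ∑ k, s k * g k ∈ F (n + 1)) :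
    L ≤ Ideal.span (Set.range g) := by
  intro f hf
  have H' : ∀ n, ∀ f : L, ∃ s : ι → A, (f : A) ∈ F n →
      (∀ k, s k ∈ F (n - c)) ∧ (f : A) - ∑ k, s k * g k ∈ F (n + 1) := by
    intro n f
    by_cases h : (f : A) ∈ F n
    · obtain ⟨s, hs⟩ := H n f f.2 h
      exact ⟨s, fun _ => hs⟩
    · exact ⟨0, fun h' => absurd h' h⟩
  choose s hs using H'
  -- `φ n` is the remainder in `F n` after `n` corrections.
  let φ : ℕ → L := fun n => Nat.rec (motive := fun _ => L) ⟨f, hf⟩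
    (fun n p => ⟨p - ∑ k, s n p k * g k,
      L.sub_mem p.2 (L.sum_mem fun k _ => L.mul_mem_left _ (hg k))⟩) n
  have hφ0 : (φ 0 : A) = f := rfl
  have hφs : ∀ n, (φ (n + 1) : A) = φ n - ∑ k, s n (φ n) k * g k := fun n => rfl
  have hφF : ∀ n, (φ n : A) ∈ F n := by
    intro n
    induction n with
    | zero => rw [htop]; trivial
    | succ n ih => rw [hφs]; exact (hs n _ ih).2
  have hsum : ∀ n, f - ∑ k, (∑ i ∈ Finset.range n, s i (φ i) k) * g k = φ n := by
    intro n
    induction n with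
    | zero => simp [hφ0]
    | succ n ih =>
      simp only [Finset.sum_range_succ, add_mul, Finset.sum_add_distrib]
      rw [hφs, ← ih]
      abel
  -- The `i`-th correction lies only in `F (i - c)`, so the partial sums are read `c` places later.
  have hlim : ∀ k, ∃ l, ∀ n, l - ∑ i ∈ Finset.range (n + c), s i (φ i) k ∈ F n := by
    intro k
    refine hcomplete (fun n => ∑ i ∈ Finset.range (n + c), s i (φ i) k) fun n => ?_
    rw [show n + 1 + c = n + c + 1 by omega, Finset.sum_range_succ, add_sub_cancel_left]
    have := (hs (n + c) _ (hφF (n + c))).1 k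
    rwa [Nat.add_sub_cancel] at this
  choose l hl using hlim
  have : f - ∑ k, l k * g k = 0 := by
    refine hsep _ fun n => ?_
    have e : f - ∑ k, l k * g k =
        φ (n + c) - ∑ k, (l k - ∑ i ∈ Finset.range (n + c), s i (φ i) k) * g k := by
      rw [← hsum]
      simp only [sub_mul, Finset.sum_sub_distrib]
      abel
    rw [e]
    exact sub_mem (hanti (Nat.le_add_right n c) (hφF _))
      (sum_mem fun k _ => hmul n _ (hl k n) _)
  rw [sub_eq_zero.1 this]
  exact Ideal.sum_mem _ fun k _ => Ideal.mul_mem_left _ _ (Ideal.subset_span ⟨k, rfl⟩)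

/-! ### Leading forms in the associated graded ring -/

section Graded

variable {R : Type*} [Ring R] {I : Ideal R}

/-- The homogeneous element of degree `n` of the associated graded ring given by `a ∈ I ^ n`. -/
def homogeneous (n : ℕ) (a : R) (ha : a ∈ I ^ n) : AssociatedGraded I :=
  DirectSum.of (GradedPiece I) n (GradedPiece.mk ⟨a, ha⟩)

lemma homogeneous_apply_self (n : ℕ) (a : R) (ha : a ∈ I ^ n) :
    homogeneous n a ha n = GradedPiece.mk ⟨a, ha⟩ :=
  DirectSum.of_eq_same _ _

lemma homogeneous_apply_of_ne {m n : ℕ} (hmn : m ≠ n) (a : R) (ha : a ∈ I ^ m) :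
    homogeneous m a ha n = 0 :=
  DirectSum.of_eq_of_ne _ _ _ hmn.symm

lemma mk_add {n : ℕ} {a b : R} (ha : a ∈ I ^ n) (hb : b ∈ I ^ n) (hab : a + b ∈ I ^ n) :
    GradedPiece.mk ⟨a, ha⟩ + GradedPiece.mk ⟨b, hb⟩ = GradedPiece.mk ⟨a + b, hab⟩ := rfl

lemma sub_sum_mem_of_mk_eq_sum {κ : Type*} (s : Finset κ) {p : ℕ} {a : R} (ha : a ∈ I ^ p)
    (b : κ → R) (hb : ∀ k, b k ∈ I ^ p)
    (h : ∑ k ∈ s, GradedPiece.mk ⟨b k, hb k⟩ = GradedPiece.mk ⟨a, ha⟩) :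
    a - ∑ k ∈ s, b k ∈ I ^ (p + 1) := by
  have e : ∑ k ∈ s, GradedPiece.mk ⟨b k, hb k⟩ =
      GradedPiece.mk (∑ k ∈ s, (⟨b k, hb k⟩ : ↥(I ^ p))) :=
    (map_sum (Submodule.mkQ _) _ _).symm
  rw [e] at h
  have := GradedPiece.mk_eq_mk.1 h.symm
  simpa using this

variable [I.IsTwoSided]

lemma homogeneous_mul {m n : ℕ} {a b : R} (ha : a ∈ I ^ m) (hb : b ∈ I ^ n) :
    homogeneous m a ha * homogeneous n b hb =
      homogeneous (m + n) (a * b) (mul_mem_pow_add ha hb) :=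
  DirectSum.of_mul_of _ _

/-- Only the component of `c` in degree `p - q` contributes, and `r` lifts it. For `p < q` the
truncated exponent `p - q = 0` carries no information, so the vanishing of `r` is recorded
separately. -/
lemma exists_mul_homogeneous_apply (q p : ℕ) (a : R) (ha : a ∈ I ^ q) (c : AssociatedGraded I) :
    ∃ r ∈ I ^ (p - q), (p < q → r = 0) ∧
      ∃ hr : r * a ∈ I ^ p, (c * homogeneous q a ha) p = GradedPiece.mk ⟨r * a, hr⟩ := by
  induction c using DirectSum.induction_on with
  | zero =>
    refine ⟨0, zero_mem _, fun _ => rfl, by simp, ?_⟩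
    refine (congrArg (fun t : AssociatedGraded I => t p) (zero_mul _)).trans ?_
    rw [DirectSum.zero_apply, eq_comm, Submodule.Quotient.mk_eq_zero]
    simp
  | of i x =>
    obtain ⟨⟨b, hb⟩, rfl⟩ := Submodule.Quotient.mk_surjective _ x
    have e : DirectSum.of (GradedPiece I) i (GradedPiece.mk ⟨b, hb⟩) = homogeneous i b hb := rfl
    rw [e, homogeneous_mul]
    by_cases hp : i + q = p
    · subst hp
      refine ⟨b, by rwa [Nat.add_sub_cancel], fun h => by omega, mul_mem_pow_add hb ha, ?_⟩
      rw [homogeneous_apply_self]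
    · refine ⟨0, zero_mem _, fun _ => rfl, by simp, ?_⟩
      rw [homogeneous_apply_of_ne hp, eq_comm, Submodule.Quotient.mk_eq_zero]
      simp
  | add x y hx hy =>
    obtain ⟨r, hr, hr0, hra, hrx⟩ := hx
    obtain ⟨s, hs, hs0, hsa, hsy⟩ := hy
    have hm : (r + s) * a ∈ I ^ p := by rw [add_mul]; exact add_mem hra hsa
    refine ⟨r + s, add_mem hr hs, fun h => by rw [hr0 h, hs0 h, add_zero], hm, ?_⟩
    refine (congrArg (fun t : AssociatedGraded I => t p) (Distrib.right_distrib x y _)).trans ?_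
    rw [DirectSum.add_apply, hrx, hsy, mk_add hra hsa (add_mem hra hsa)]
    simp only [add_mul]

lemma exists_homogeneous_mul_apply (q p : ℕ) (a : R) (ha : a ∈ I ^ q) (c : AssociatedGraded I) :
    ∃ r ∈ I ^ (p - q), (p < q → r = 0) ∧
      ∃ hr : a * r ∈ I ^ p, (homogeneous q a ha * c) p = GradedPiece.mk ⟨a * r, hr⟩ := by
  induction c using DirectSum.induction_on with
  | zero =>
    refine ⟨0, zero_mem _, fun _ => rfl, by simp, ?_⟩
    refine (congrArg (fun t : AssociatedGraded I => t p) (mul_zero _)).trans ?_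
    rw [DirectSum.zero_apply, eq_comm, Submodule.Quotient.mk_eq_zero]
    simp
  | of i x =>
    obtain ⟨⟨b, hb⟩, rfl⟩ := Submodule.Quotient.mk_surjective _ x
    have e : DirectSum.of (GradedPiece I) i (GradedPiece.mk ⟨b, hb⟩) = homogeneous i b hb := rfl
    rw [e, homogeneous_mul]
    by_cases hp : q + i = p
    · subst hp
      refine ⟨b, by rwa [Nat.add_sub_cancel_left], fun h => by omega, mul_mem_pow_add ha hb, ?_⟩
      rw [homogeneous_apply_self]
    · refine ⟨0, zero_mem _, fun _ => rfl, by simp, ?_⟩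
      rw [homogeneous_apply_of_ne hp, eq_comm, Submodule.Quotient.mk_eq_zero]
      simp
  | add x y hx hy =>
    obtain ⟨r, hr, hr0, hra, hrx⟩ := hx
    obtain ⟨s, hs, hs0, hsa, hsy⟩ := hy
    have hm : a * (r + s) ∈ I ^ p := by rw [mul_add]; exact add_mem hra hsa
    refine ⟨r + s, add_mem hr hs, fun h => by rw [hr0 h, hs0 h, add_zero], hm, ?_⟩
    refine (congrArg (fun t : AssociatedGraded I => t p) (Distrib.left_distrib _ x y)).trans ?_
    rw [DirectSum.add_apply, hrx, hsy, mk_add hra hsa (add_mem hra hsa)]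
    simp only [mul_add]

/-- If `Gr_I R` is left Noetherian, then finitely many members of a family of elements of powers of
`I` generate all the others on the left modulo higher powers of `I`, compatibly with degrees. -/
lemma exists_finset_left_approx (hN : IsNoetherianRing (AssociatedGraded I)) {ι : Type*}
    (a : ι → R) (p d : ι → ℕ) (ha : ∀ i, a i ∈ I ^ p i) :
    ∃ K : Finset ι, ∀ i, ∃ r : K → R, (∀ k : K, r k ∈ I ^ (p i - p k)) ∧
      (∀ k : K, p i < p k ∨ d i < d k → r k = 0) ∧ a i - ∑ k : K, r k * a k ∈ I ^ (p i + 1) := by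
  classical
  obtain ⟨K, hK⟩ := exists_finset_mem_span (fun i => homogeneous (p i) (a i) (ha i)) d
  refine ⟨K, fun i => ?_⟩
  obtain ⟨c, hc⟩ := (Submodule.mem_span_image_finset_iff_exists_fun _).1 (hK i)
  choose r hr hr0 hra hrc using fun k => exists_mul_homogeneous_apply (p k) (p i) (a k) (ha k)
    (if h : k ∈ ({k ∈ K | d k ≤ d i} : Finset ι) then c ⟨k, h⟩ else 0)
  -- The span only involves generators with `d k ≤ d i`; the other coefficients are set to zero so
  -- that all sums run over `K`.
  refine ⟨fun k => if d k ≤ d i then r (k : ι) else 0, fun k => ?_, fun k hk => ?_, ?_⟩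
  · dsimp only
    split_ifs
    exacts [hr k, zero_mem _]
  · dsimp only
    split_ifs with h
    · exact hr0 k (hk.resolve_right (by omega))
    · rfl
  · have h1 := congrArg (fun x : AssociatedGraded I => x (p i)) hc
    simp only [homogeneous_apply_self, smul_eq_mul] at h1
    rw [DFinsupp.finsetSum_apply] at h1
    have h2 := sub_sum_mem_of_mk_eq_sum ({k ∈ K | d k ≤ d i} : Finset ι) (ha i)
      (fun k : ι => r k * a k) hra (by
        rw [← h1, ← Finset.sum_coe_sort]
        refine Finset.sum_congr rfl fun k _ => ?_
        rw [← hrc, dif_pos k.2])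
    rw [Finset.sum_filter, ← Finset.sum_coe_sort] at h2
    simpa only [ite_mul, zero_mul] using h2

/-- If `Gr_I R` is right Noetherian, then finitely many members of a family of elements of powers of
`I` generate all the others on the right modulo higher powers of `I`, compatibly with degrees. -/
lemma exists_finset_right_approx (hN : IsNoetherianRing (AssociatedGraded I)ᵐᵒᵖ) {ι : Type*}
    (a : ι → R) (p d : ι → ℕ) (ha : ∀ i, a i ∈ I ^ p i) :
    ∃ K : Finset ι, ∀ i, ∃ r : K → R, (∀ k : K, r k ∈ I ^ (p i - p k)) ∧
      (∀ k : K, p i < p k ∨ d i < d k → r k = 0) ∧ a i - ∑ k : K, a k * r k ∈ I ^ (p i + 1) := by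
  classical
  obtain ⟨K, hK⟩ :=
    exists_finset_mem_span (fun i => MulOpposite.op (homogeneous (p i) (a i) (ha i))) d
  refine ⟨K, fun i => ?_⟩
  obtain ⟨c, hc⟩ := (Submodule.mem_span_image_finset_iff_exists_fun _).1 (hK i)
  choose r hr hr0 hra hrc using fun k => exists_homogeneous_mul_apply (p k) (p i) (a k) (ha k)
    (if h : k ∈ ({k ∈ K | d k ≤ d i} : Finset ι) then (c ⟨k, h⟩).unop else 0)
  refine ⟨fun k => if d k ≤ d i then r (k : ι) else 0, fun k => ?_, fun k hk => ?_, ?_⟩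
  · dsimp only
    split_ifs
    exacts [hr k, zero_mem _]
  · dsimp only
    split_ifs with h
    · exact hr0 k (hk.resolve_right (by omega))
    · rfl
  · have h1 := congrArg (fun x : (AssociatedGraded I)ᵐᵒᵖ => x.unop (p i)) hc
    simp only [smul_eq_mul, MulOpposite.unop_op, homogeneous_apply_self, Finset.unop_sum,
      MulOpposite.unop_mul] at h1
    rw [DFinsupp.finsetSum_apply] at h1
    have h2 := sub_sum_mem_of_mk_eq_sum ({k ∈ K | d k ≤ d i} : Finset ι) (ha i)
      (fun k => a k * r k) hra (by
        rw [← h1, ← Finset.sum_coe_sort]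
        refine Finset.sum_congr rfl fun k _ => ?_
        rw [← hrc, dif_pos k.2])
    rw [Finset.sum_filter, ← Finset.sum_coe_sort] at h2
    simpa only [mul_ite, mul_zero] using h2

end Graded

/-! ### Estimates for coefficients and leading coefficients of products -/

section Leading

variable {R : Type*} [Ring R] {I : Ideal R} {σ : R →+* R} {δ : R →+ R}

/-- The coefficients `fⱼ` lie in `I ^ (n - j)`, and even in `I ^ (n + 1 - j)` when `i ≤ j`. -/
def LeadBound (I : Ideal R) (n i : ℕ) (f : ℕ → R) : Prop :=
  ∀ j, f j ∈ I ^ (n - j) ∧ (i ≤ j → f j ∈ I ^ (n + 1 - j))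

lemma mem_pow_of_le {r : R} {m n : ℕ} (hr : r ∈ I ^ n) (hmn : m ≤ n) : r ∈ I ^ m :=
  Ideal.pow_le_pow_right hmn hr

lemma mul_mem_pow_of_le [I.IsTwoSided] {m n k : ℕ} {a b : R} (ha : a ∈ I ^ m) (hb : b ∈ I ^ n)
    (hk : k ≤ m + n) : a * b ∈ I ^ k :=
  mem_pow_of_le (mul_mem_pow_add ha hb) hk

/-- In `δ(xy) = σ(x) δ(y) + δ(x) y` with `x ∈ I ^ n` and `y ∈ I`, the first term gains a degree from
`δ(I) ⊆ I ^ 2` and the second by induction. -/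
lemma derivation_pow_mem_succ [I.IsTwoSided] (h : IsAdmissible I σ δ) (hδ : ∀ r, δ r ∈ I)
    (hδI : ∀ a ∈ I, δ a ∈ I ^ 2) (n : ℕ) : ∀ a ∈ I ^ n, δ a ∈ I ^ (n + 1) := by
  induction n with
  | zero =>
    intro a _
    rw [zero_add, Submodule.pow_one]
    exact hδ a
  | succ n ih =>
    intro a ha
    rw [Submodule.pow_succ] at ha
    refine Submodule.mul_induction_on ha (fun x hx y hy => ?_) (fun x y hx hy => ?_)
    · rw [h.derivation]
      have hy' : y ∈ I ^ 1 := by rwa [Submodule.pow_one]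
      exact add_mem (mul_mem_pow_of_le (map_pow_mem h n x hx) (hδI y hy) (by omega))
        (mul_mem_pow_of_le (ih x hx) hy' (by omega))
    · rw [map_add]
      exact add_mem hx hy

lemma exists_mem_pow_map_eq (hσ : ∀ a ∈ I, ∃ b ∈ I, σ b = a) (hσ' : Function.Surjective σ)
    (n : ℕ) : ∀ a ∈ I ^ n, ∃ b ∈ I ^ n, σ b = a := by
  induction n with
  | zero =>
    intro a _
    obtain ⟨b, rfl⟩ := hσ' a
    exact ⟨b, mem_pow_zero I b, rfl⟩
  | succ n ih =>
    intro a ha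
    rw [Submodule.pow_succ] at ha
    refine Submodule.mul_induction_on ha (fun x hx y hy => ?_) (fun x y hx hy => ?_)
    · obtain ⟨x', hx', rfl⟩ := ih x hx
      obtain ⟨y', hy', rfl⟩ := hσ y hy
      refine ⟨x' * y', ?_, map_mul _ _ _⟩
      rw [Submodule.pow_succ]
      exact Ideal.mul_mem_mul hx' hy'
    · obtain ⟨x', hx', rfl⟩ := hx
      obtain ⟨y', hy', rfl⟩ := hy
      exact ⟨x' + y', add_mem hx' hy', map_add _ _ _⟩

lemma exists_mem_pow_iterate_eq (hσ : ∀ a ∈ I, ∃ b ∈ I, σ b = a) (hσ' : Function.Surjective σ)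
    (n j : ℕ) : ∀ a ∈ I ^ n, ∃ b ∈ I ^ n, σ^[j] b = a := by
  induction j with
  | zero => exact fun a ha => ⟨a, ha, rfl⟩
  | succ j ih =>
    intro a ha
    obtain ⟨b, hb, rfl⟩ := ih a ha
    obtain ⟨c, hc, rfl⟩ := exists_mem_pow_map_eq hσ hσ' n b hb
    exact ⟨c, hc, rfl⟩

lemma iterate_pow_mem (h : IsAdmissible I σ δ) (n j : ℕ) {a : R} (ha : a ∈ I ^ n) :
    σ^[j] a ∈ I ^ n := by
  induction j with
  | zero => exact ha
  | succ j ih => rw [Function.iterate_succ_apply']; exact map_pow_mem h n _ ih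

lemma LeadBound.mulX [I.IsTwoSided] (h : IsAdmissible I σ δ)
    (hδ : ∀ n, ∀ a ∈ I ^ n, δ a ∈ I ^ (n + 1)) {n i : ℕ} {f : ℕ → R} (hf : LeadBound I n i f) :
    LeadBound I (n + 1) (i + 1) (mulX σ δ f) := by
  intro j
  cases j with
  | zero => exact ⟨mem_pow_of_le (hδ _ _ (hf 0).1) (by omega), fun h => by omega⟩
  | succ j =>
    refine ⟨add_mem (mem_pow_of_le (map_pow_mem h _ _ (hf j).1) (by omega))
      (mem_pow_of_le (hδ _ _ (hf (j + 1)).1) (by omega)), fun hj => ?_⟩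
    exact add_mem (mem_pow_of_le (map_pow_mem h _ _ ((hf j).2 (by omega))) (by omega))
      (mem_pow_of_le (hδ _ _ ((hf (j + 1)).2 (by omega))) (by omega))

lemma LeadBound.mulX_iterate [I.IsTwoSided] (h : IsAdmissible I σ δ)
    (hδ : ∀ n, ∀ a ∈ I ^ n, δ a ∈ I ^ (n + 1)) {n i : ℕ} {f : ℕ → R} (hf : LeadBound I n i f)
    (j : ℕ) : LeadBound I (n + j) (i + j) ((SkewSeries.mulX σ δ)^[j] f) := by
  induction j with
  | zero => exact hf
  | succ j ih => rw [Function.iterate_succ_apply']; exact ih.mulX h hδ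

/-- The coefficient of `x ^ (i + j + 1)` in `x * (xʲ f)` is `σ` of the previous leading coefficient
plus `δ` of a coefficient beyond the leading position. The latter is in `I ^ (n - i)`, so `δ` moves
it into `I ^ (n + 1 - i)`. -/
lemma LeadBound.mulX_iterate_sub_mem [I.IsTwoSided] (h : IsAdmissible I σ δ)
    (hδ : ∀ n, ∀ a ∈ I ^ n, δ a ∈ I ^ (n + 1)) {n i : ℕ} {f : ℕ → R}
    (hf : LeadBound I n (i + 1) f) (j : ℕ) :
    (SkewSeries.mulX σ δ)^[j] f (i + j) - σ^[j] (f i) ∈ I ^ (n + 1 - i) := by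
  induction j with
  | zero => simp
  | succ j ih =>
    rw [Function.iterate_succ_apply', Function.iterate_succ_apply']
    have e : SkewSeries.mulX σ δ ((SkewSeries.mulX σ δ)^[j] f) (i + (j + 1)) =
      σ ((SkewSeries.mulX σ δ)^[j] f (i + j)) + δ ((SkewSeries.mulX σ δ)^[j] f (i + j + 1)) := rfl
    rw [e, add_sub_right_comm, ← map_sub]
    exact add_mem (map_pow_mem h _ _ ih)
      (mem_pow_of_le (hδ _ _ (((hf.mulX_iterate h hδ j) (i + j + 1)).2 (by omega))) (by omega))

/-- A coefficient of a product is a finite sum modulo `I ^ n`, so a single term `a l * xˡ b` may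
determine it. -/
lemma seriesMul_sub_mem (h : IsAdmissible I σ δ) {n m : ℕ} {a b : ℕ → R} {r : R} (l : ℕ)
    (h1 : a l * (mulX σ δ)^[l] b m - r ∈ I ^ n)
    (h2 : ∀ j, j ≠ l → a j * (mulX σ δ)^[j] b m ∈ I ^ n) :
    seriesMul I σ δ a b m - r ∈ I ^ n := by
  obtain ⟨N, -, hN⟩ := seriesMul_approx h n m
  have A := hN (N + l + 1) (by omega) a b
  rw [← Finset.add_sum_erase _ _ (Finset.mem_range.2 (show l < N + l + 1 by omega))] at A
  have B : ∑ j ∈ (Finset.range (N + l + 1)).erase l, a j * (mulX σ δ)^[j] b m ∈ I ^ n :=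
    sum_mem fun j hj => h2 j (Finset.ne_of_mem_erase hj)
  convert add_mem A (add_mem h1 B) using 1
  abel

lemma seriesMul_mem (h : IsAdmissible I σ δ) {n m : ℕ} {a b : ℕ → R}
    (h2 : ∀ j, a j * (mulX σ δ)^[j] b m ∈ I ^ n) : seriesMul I σ δ a b m ∈ I ^ n := by
  simpa using seriesMul_sub_mem h (r := 0) 0 (by simpa using h2 0) fun j _ => h2 j

lemma LeadBound.seriesMul [I.IsTwoSided] (h : IsAdmissible I σ δ)
    (hδ : ∀ n, ∀ a ∈ I ^ n, δ a ∈ I ^ (n + 1)) {n q l i : ℕ} {f g : ℕ → R}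
    (hf : LeadBound I n (l + 1) f) (hg : LeadBound I q (i + 1) g) :
    LeadBound I (n + q) (l + i + 1) (seriesMul I σ δ f g) := by
  refine fun m => ⟨seriesMul_mem h fun j => ?_, fun hm => seriesMul_mem h fun j => ?_⟩
  · exact mul_mem_pow_of_le (hf j).1 (hg.mulX_iterate h hδ j m).1 (by omega)
  -- Either `j` is beyond the leading position of `f`, or `m` is beyond that of `xʲ g`; each case
  -- gains one power of `I`.
  · rcases Nat.lt_or_ge l j with hj | hj
    · exact mul_mem_pow_of_le ((hf j).2 hj) (hg.mulX_iterate h hδ j m).1 (by omega)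
    · exact mul_mem_pow_of_le (hf j).1 ((hg.mulX_iterate h hδ j m).2 (by omega)) (by omega)

lemma LeadBound.seriesMul_sub_mem [I.IsTwoSided] (h : IsAdmissible I σ δ)
    (hδ : ∀ n, ∀ a ∈ I ^ n, δ a ∈ I ^ (n + 1)) {n q l i : ℕ} {f g : ℕ → R}
    (hf : LeadBound I n (l + 1) f) (hg : LeadBound I q (i + 1) g) :
    SkewSeries.seriesMul I σ δ f g (l + i) - f l * σ^[l] (g i) ∈ I ^ (n + q + 1 - (l + i)) := by
  refine SkewSeries.seriesMul_sub_mem h l ?_ fun j hj => ?_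
  · rw [← mul_sub, add_comm l i]
    exact mul_mem_pow_of_le (hf l).1 (hg.mulX_iterate_sub_mem h hδ l) (by omega)
  · rcases Nat.lt_or_ge l j with hj' | hj'
    · exact mul_mem_pow_of_le ((hf j).2 hj') (hg.mulX_iterate h hδ j _).1 (by omega)
    · exact mul_mem_pow_of_le (hf j).1 ((hg.mulX_iterate h hδ j _).2 (by omega)) (by omega)

lemma LeadBound.single {p j : ℕ} {r : R} (hr : r ∈ I ^ p) :
    LeadBound I (p + j) (j + 1) (Pi.single j r) := by
  intro m
  by_cases hm : m = j
  · subst hm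
    rw [Pi.single_eq_same]
    exact ⟨by simpa using hr, fun h => by omega⟩
  · rw [Pi.single_eq_of_ne hm]
    exact ⟨zero_mem _, fun _ => zero_mem _⟩

end Leading

/-! ### The filtration of the series ring by total degree -/

namespace SkewPowerSeries

variable {R : Type*} [Ring R] {I : Ideal R} {σ : R →+* R} {δ : R →+ R} {h : IsAdmissible I σ δ}

/-- The coefficient of `xʲ`. -/
def coeff (j : ℕ) : SkewPowerSeries h →+ R := Pi.evalAddMonoidHom (fun _ => R) j

/-- The series `r xʲ`. -/
def monomial (h : IsAdmissible I σ δ) (j : ℕ) (r : R) : SkewPowerSeries h :=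
  (Pi.single j r : ℕ → R)

lemma ext {f g : SkewPowerSeries h} (hfg : ∀ j, coeff j f = coeff j g) : f = g := funext hfg

lemma coeff_monomial_self (j : ℕ) (r : R) : coeff j (monomial h j r) = r :=
  Pi.single_eq_same (M := fun _ => R) j r

variable (h) in
/-- The series `f` with `LeadBound I n i f`. -/
def leadSubgroup (n i : ℕ) : AddSubgroup (SkewPowerSeries h) where
  carrier := {f | LeadBound I n i fun j => coeff j f}
  zero_mem' j := by simp
  add_mem' hf hg j := by
    simp only [map_add]
    exact ⟨add_mem (hf j).1 (hg j).1, fun hj => add_mem ((hf j).2 hj) ((hg j).2 hj)⟩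
  neg_mem' hf j := by
    simp only [map_neg]
    exact ⟨neg_mem (hf j).1, fun hj => neg_mem ((hf j).2 hj)⟩

variable (h) in
/-- The series with coefficients `fⱼ ∈ I ^ (n - j)`. -/
def totalFiltration (n : ℕ) : AddSubgroup (SkewPowerSeries h) where
  carrier := {f | ∀ j, coeff j f ∈ I ^ (n - j)}
  zero_mem' j := by simp
  add_mem' hf hg j := by
    simp only [map_add]
    exact add_mem (hf j) (hg j)
  neg_mem' hf j := by
    simp only [map_neg]
    exact neg_mem (hf j)

lemma mem_leadSubgroup {n i : ℕ} {f : SkewPowerSeries h} :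
    f ∈ leadSubgroup h n i ↔
      ∀ j, coeff j f ∈ I ^ (n - j) ∧ (i ≤ j → coeff j f ∈ I ^ (n + 1 - j)) := Iff.rfl

lemma leadSubgroup_zero (n : ℕ) : leadSubgroup h n 0 = totalFiltration h (n + 1) := by
  ext f
  exact ⟨fun hf j => (hf j).2 (Nat.zero_le _),
    fun hf j => ⟨mem_pow_of_le (hf j) (by omega), fun _ => hf j⟩⟩

/-- For `j > n` the exponent `n + 1 - j` is zero, so positions beyond `n` impose no condition. -/
lemma leadSubgroup_of_lt {n i : ℕ} (hi : n < i) : leadSubgroup h n i = totalFiltration h n := by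
  ext f
  refine ⟨fun hf j => (hf j).1, fun hf j => ⟨hf j, fun hj => ?_⟩⟩
  rw [show n + 1 - j = 0 by omega]
  exact mem_pow_zero I _

lemma leadSubgroup_le (n i : ℕ) : leadSubgroup h n i ≤ totalFiltration h n :=
  fun _ hf j => (hf j).1

lemma mem_leadSubgroup_of_succ {n i : ℕ} {f : SkewPowerSeries h}
    (hf : f ∈ leadSubgroup h n (i + 1)) (hi : coeff i f ∈ I ^ (n + 1 - i)) :
    f ∈ leadSubgroup h n i := by
  refine fun j => ⟨(hf j).1, fun hj => ?_⟩
  rcases hj.eq_or_lt with rfl | hj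
  exacts [hi, (hf j).2 hj]

lemma totalFiltration_antitone : Antitone (totalFiltration h) :=
  fun _ _ hmn _ hf j => mem_pow_of_le (hf j) (by omega)

lemma totalFiltration_zero : totalFiltration h 0 = ⊤ := by
  rw [eq_top_iff]
  intro f _ j
  rw [Nat.zero_sub]
  exact mem_pow_zero I _

lemma eq_zero_of_mem_totalFiltration (f : SkewPowerSeries h)
    (hf : ∀ n, f ∈ totalFiltration h n) : f = 0 := by
  refine ext fun j => ?_
  rw [map_zero]
  refine h.complete.separated _ fun n => ?_
  simpa using hf (n + j) j

lemma totalFiltration_complete (u : ℕ → SkewPowerSeries h)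
    (hu : ∀ n, u (n + 1) - u n ∈ totalFiltration h n) :
    ∃ s, ∀ n, s - u n ∈ totalFiltration h n := by
  -- Membership in `totalFiltration (m + j)` controls the coefficient of `xʲ` only modulo `I ^ m`,
  -- hence the shift by `j`.
  have hlim : ∀ j, ∃ s : R, ∀ m, coeff j (u (m + j)) - s ∈ I ^ m := by
    intro j
    refine h.complete.complete (fun m => coeff j (u (m + j))) fun m n hmn => ?_
    induction n, hmn using Nat.le_induction with
    | base => simp
    | succ n hmn ih =>
      have := hu (n + j) j
      rw [map_sub, Nat.add_sub_cancel] at this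
      have := add_mem (mem_pow_of_le this hmn) ih
      rwa [sub_add_sub_cancel, show n + j + 1 = n + 1 + j by omega] at this
  choose s hs using hlim
  obtain ⟨t, ht⟩ : ∃ t : SkewPowerSeries h, ∀ j, coeff j t = s j := ⟨s, fun _ => rfl⟩
  refine ⟨t, fun n j => ?_⟩
  rcases le_total j n with hj | hj
  · have := neg_mem (hs j (n - j))
    rw [neg_sub, Nat.sub_add_cancel hj] at this
    rwa [map_sub, ht]
  · rw [Nat.sub_eq_zero_of_le hj]
    exact mem_pow_zero I _

lemma monomial_mem_leadSubgroup {p j : ℕ} {r : R} (hr : r ∈ I ^ p) :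
    monomial h j r ∈ leadSubgroup h (p + j) (j + 1) := LeadBound.single hr

variable [I.IsTwoSided]

lemma mul_mem_leadSubgroup (hδ : ∀ n, ∀ a ∈ I ^ n, δ a ∈ I ^ (n + 1)) {n q l i : ℕ}
    {f g : SkewPowerSeries h} (hf : f ∈ leadSubgroup h n (l + 1))
    (hg : g ∈ leadSubgroup h q (i + 1)) : f * g ∈ leadSubgroup h (n + q) (l + i + 1) :=
  LeadBound.seriesMul h hδ hf hg

lemma coeff_mul_sub_mem (hδ : ∀ n, ∀ a ∈ I ^ n, δ a ∈ I ^ (n + 1)) {n q l i : ℕ}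
    {f g : SkewPowerSeries h} (hf : f ∈ leadSubgroup h n (l + 1))
    (hg : g ∈ leadSubgroup h q (i + 1)) :
    coeff (l + i) (f * g) - coeff l f * σ^[l] (coeff i g) ∈ I ^ (n + q + 1 - (l + i)) :=
  LeadBound.seriesMul_sub_mem h hδ hf hg

lemma mul_mem_totalFiltration (hδ : ∀ n, ∀ a ∈ I ^ n, δ a ∈ I ^ (n + 1)) {n q : ℕ}
    {f g : SkewPowerSeries h} (hf : f ∈ totalFiltration h n) (hg : g ∈ totalFiltration h q) :
    f * g ∈ totalFiltration h (n + q) := by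
  rw [← leadSubgroup_of_lt (Nat.lt_succ_self _)] at *
  exact mul_mem_leadSubgroup hδ hf hg

end SkewPowerSeries

/-! ### Hilbert's basis argument for left and right ideals -/

/-- A variant of `le_span_of_approx` where each step of the filtration is refined into a finite
number of steps. -/
lemma le_span_of_refined_approx {A ι : Type*} [Ring A] [Fintype ι] (F : ℕ → AddSubgroup A)
    (hmul : ∀ n, ∀ a ∈ F n, ∀ b, a * b ∈ F n)
    (hanti : Antitone F) (htop : F 0 = ⊤) (hsep : ∀ a, (∀ n, a ∈ F n) → a = 0)
    (hcomplete : ∀ u : ℕ → A, (∀ n, u (n + 1) - u n ∈ F n) → ∃ s, ∀ n, s - u n ∈ F n)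
    (G : ℕ → ℕ → AddSubgroup A) (hG : ∀ n, G n (n + 1) = F n) (hG0 : ∀ n, G n 0 = F (n + 1))
    (L : Ideal A) (g : ι → A) (hg : ∀ k, g k ∈ L) (c : ℕ)
    (H : ∀ n i, i ≤ n → ∀ f ∈ L, f ∈ G n (i + 1) →
      ∃ s : ι → A, (∀ k, s k ∈ F (n - c)) ∧ f - ∑ k, s k * g k ∈ G n i) :
    L ≤ Ideal.span (Set.range g) := by
  refine le_span_of_approx F hmul hanti htop hsep hcomplete L g hg c fun n f hf hfn => ?_
  have key : ∀ i ≤ n + 1, ∀ f ∈ L, f ∈ G n i →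
      ∃ s : ι → A, (∀ k, s k ∈ F (n - c)) ∧ f - ∑ k, s k * g k ∈ G n 0 := by
    intro i
    induction i with
    | zero => exact fun _ f _ hf => ⟨0, fun k => zero_mem _, by simpa using hf⟩
    | succ i ih =>
      intro hi f hfL hf
      obtain ⟨s, hs, hfs⟩ := H n i (by omega) f hfL hf
      obtain ⟨t, ht, hft⟩ := ih (by omega) _
        (L.sub_mem hfL (L.sum_mem fun k _ => L.mul_mem_left _ (hg k))) hfs
      refine ⟨s + t, fun k => add_mem (hs k) (ht k), ?_⟩
      simpa only [Pi.add_apply, add_mul, Finset.sum_add_distrib, sub_sub] using hft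
  rw [← hG0]
  exact key (n + 1) le_rfl f hf (by rwa [hG])

namespace SkewPowerSeries

variable {R : Type*} [Ring R] {I : Ideal R} {σ : R →+* R} {δ : R →+ R} {h : IsAdmissible I σ δ}
  [I.IsTwoSided]

theorem isNoetherianRing_of_associatedGraded (hδ : ∀ n, ∀ a ∈ I ^ n, δ a ∈ I ^ (n + 1))
    (hσ : ∀ a ∈ I, ∃ b ∈ I, σ b = a) (hσ' : Function.Surjective σ)
    (hN : IsNoetherianRing (AssociatedGraded I)) : IsNoetherianRing (SkewPowerSeries h) := by
  rw [isNoetherianRing_iff_ideal_fg]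
  intro L
  -- The tuple `(f, p, d, a)` records a member of `L` of total degree `p + d` with leading term
  -- `σᵈ(a) xᵈ`. Using `a` in place of `σᵈ(a)` makes coefficients from different `x`-degrees
  -- comparable under left multiplication.
  let ι := {x : SkewPowerSeries h × ℕ × ℕ × R // x.1 ∈ L ∧
    x.1 ∈ leadSubgroup h (x.2.1 + x.2.2.1) (x.2.2.1 + 1) ∧ x.2.2.2 ∈ I ^ x.2.1 ∧
    coeff x.2.2.1 x.1 = σ^[x.2.2.1] x.2.2.2}
  let g : ι → SkewPowerSeries h := fun x => x.1.1
  let p : ι → ℕ := fun x => x.1.2.1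
  let d : ι → ℕ := fun x => x.1.2.2.1
  let a : ι → R := fun x => x.1.2.2.2
  have hgL : ∀ x, g x ∈ L := fun x => x.2.1
  have hglead : ∀ x, g x ∈ leadSubgroup h (p x + d x) (d x + 1) := fun x => x.2.2.1
  have ha : ∀ x, a x ∈ I ^ p x := fun x => x.2.2.2.1
  have hga : ∀ x, coeff (d x) (g x) = σ^[d x] (a x) := fun x => x.2.2.2.2
  obtain ⟨K, hK⟩ := exists_finset_left_approx hN a p d ha
  have hle : L ≤ Ideal.span (Set.range fun k : K => g k) := by
    refine le_span_of_refined_approx (totalFiltration h)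
      (fun n a ha b => mul_mem_totalFiltration hδ (q := 0) ha (by simp [totalFiltration_zero]))
      totalFiltration_antitone totalFiltration_zero eq_zero_of_mem_totalFiltration
      totalFiltration_complete (leadSubgroup h) (fun n => leadSubgroup_of_lt n.lt_succ_self)
      leadSubgroup_zero L _ (fun k => hgL k) (K.sup fun k => p k + d k) fun n i hi f hfL hf => ?_
    obtain ⟨b, hb, hbf⟩ := exists_mem_pow_iterate_eq hσ hσ' (n - i) i _ (hf i).1
    obtain ⟨r, hr, hr0, hra⟩ := hK ⟨(f, n - i, i, b), hfL, by rwa [Nat.sub_add_cancel hi], hb,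
      hbf.symm⟩
    change ∀ k : K, r k ∈ I ^ (n - i - p k) at hr
    change ∀ k : K, n - i < p k ∨ i < d k → r k = 0 at hr0
    change b - ∑ k : K, r k * a k ∈ I ^ (n - i + 1) at hra
    have hs : ∀ k : K, ∃ s : SkewPowerSeries h,
        s ∈ totalFiltration h (n - K.sup fun k => p k + d k) ∧
        s * g k ∈ leadSubgroup h n (i + 1) ∧
        coeff i (s * g k) - σ^[i] (r k * a k) ∈ I ^ (n + 1 - i) := by
      intro k
      have hc : p k + d k ≤ K.sup fun k => p k + d k :=
        Finset.le_sup (f := fun k => p k + d k) k.2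
      by_cases hk : n - i < p k ∨ i < d k
      · exact ⟨0, zero_mem _, by simp, by simp [hr0 k hk, iterate_map_zero]⟩
      push Not at hk
      have hm := monomial_mem_leadSubgroup (h := h) (j := i - d k) (iterate_pow_mem h _ i (hr k))
      have e1 : n - i - p k + (i - d k) + (p k + d k) = n := by omega
      have e2 : i - d k + d k = i := by omega
      -- Modulo higher powers, `σⁱ(r k) x ^ (i - d k) * g k` has leading coefficient `σⁱ(r k) σ ^ (i
      -- - d k) (σ ^ (d k) (a k)) = σⁱ(r k * a k)`.
      refine ⟨monomial h (i - d k) (σ^[i] (r k)),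
        totalFiltration_antitone (by omega) (leadSubgroup_le _ _ hm), ?_, ?_⟩
      · have := mul_mem_leadSubgroup hδ hm (hglead k)
        rwa [e1, e2] at this
      · have := coeff_mul_sub_mem hδ hm (hglead k)
        rw [e1, e2, coeff_monomial_self, hga, ← Function.iterate_add_apply, e2,
          ← iterate_map_mul] at this
        exact this
    choose s hs hsg hsc using hs
    refine ⟨s, hs, mem_leadSubgroup_of_succ (sub_mem hf (sum_mem fun k _ => hsg k)) ?_⟩
    have h1 := iterate_pow_mem h _ i hra
    rw [show n - i + 1 = n + 1 - i by omega, iterate_map_sub, hbf, ← RingHom.coe_pow, map_sum] at h1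
    have h2 := sub_mem h1 (sum_mem fun k (_ : k ∈ Finset.univ) => hsc k)
    rw [map_sub, map_sum]
    simp only [Finset.sum_sub_distrib, RingHom.coe_pow] at h2
    convert h2 using 1
    abel
  have hge : Ideal.span (Set.range fun k : K => g k) ≤ L := by
    rw [Ideal.span_le]
    rintro _ ⟨k, rfl⟩
    exact hgL k
  rw [le_antisymm hle hge]
  exact Submodule.fg_span (Set.finite_range _)

theorem isNoetherianRing_op_of_associatedGraded (hδ : ∀ n, ∀ a ∈ I ^ n, δ a ∈ I ^ (n + 1))
    (hσ : ∀ a ∈ I, ∃ b ∈ I, σ b = a) (hσ' : Function.Surjective σ)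
    (hN : IsNoetherianRing (AssociatedGraded I)ᵐᵒᵖ) :
    IsNoetherianRing (SkewPowerSeries h)ᵐᵒᵖ := by
  rw [isNoetherianRing_iff_ideal_fg]
  intro L
  -- Right multiplication leaves the factor `coeff d f` untouched and twists the multiplier instead,
  -- so leading coefficients need no untwisting here.
  let ι := {x : SkewPowerSeries h × ℕ × ℕ // MulOpposite.op x.1 ∈ L ∧
    x.1 ∈ leadSubgroup h (x.2.1 + x.2.2) (x.2.2 + 1)}
  let g : ι → SkewPowerSeries h := fun x => x.1.1
  let p : ι → ℕ := fun x => x.1.2.1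
  let d : ι → ℕ := fun x => x.1.2.2
  have hgL : ∀ x, MulOpposite.op (g x) ∈ L := fun x => x.2.1
  have hglead : ∀ x, g x ∈ leadSubgroup h (p x + d x) (d x + 1) := fun x => x.2.2
  have ha : ∀ x, coeff (d x) (g x) ∈ I ^ p x := fun x => by
    simpa using (mem_leadSubgroup.1 (hglead x) (d x)).1
  obtain ⟨K, hK⟩ := exists_finset_right_approx hN (fun x => coeff (d x) (g x)) p d ha
  let e : (SkewPowerSeries h)ᵐᵒᵖ →+ SkewPowerSeries h :=
    (MulOpposite.opAddEquiv (α := SkewPowerSeries h)).symm.toAddMonoidHom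
  have hle : L ≤ Ideal.span (Set.range fun k : K => MulOpposite.op (g k)) := by
    refine le_span_of_refined_approx (fun n => (totalFiltration h n).comap e)
      (fun n a ha b => ?_) (fun m n hmn => AddSubgroup.comap_mono (totalFiltration_antitone hmn))
      (by rw [totalFiltration_zero, AddSubgroup.comap_top])
      (fun a ha => MulOpposite.unop_injective (eq_zero_of_mem_totalFiltration _ ha))
      (fun u hu => ?_) (fun n i => (leadSubgroup h n i).comap e)
      (fun n => by rw [leadSubgroup_of_lt n.lt_succ_self])
      (fun n => by rw [leadSubgroup_zero]) L _ (fun k => hgL k) (K.sup fun k => p k + d k)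
      fun n i hi f hfL hf => ?_
    · have := mul_mem_totalFiltration hδ (n := 0) (f := b.unop) (by simp [totalFiltration_zero]) ha
      rwa [zero_add] at this
    · obtain ⟨s, hs⟩ := totalFiltration_complete (fun n => (u n).unop) hu
      exact ⟨MulOpposite.op s, hs⟩
    obtain ⟨f, rfl⟩ := MulOpposite.op_surjective f
    change f ∈ leadSubgroup h n (i + 1) at hf
    obtain ⟨r, hr, hr0, hra⟩ := hK ⟨(f, n - i, i), hfL, by rwa [Nat.sub_add_cancel hi]⟩
    change ∀ k : K, r k ∈ I ^ (n - i - p k) at hr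
    change ∀ k : K, n - i < p k ∨ i < d k → r k = 0 at hr0
    change coeff i f - ∑ k : K, coeff (d k) (g k) * r k ∈ I ^ (n - i + 1) at hra
    have hs : ∀ k : K, ∃ s : SkewPowerSeries h,
        s ∈ totalFiltration h (n - K.sup fun k => p k + d k) ∧
        g k * s ∈ leadSubgroup h n (i + 1) ∧
        coeff i (g k * s) - coeff (d k) (g k) * r k ∈ I ^ (n + 1 - i) := by
      intro k
      have hc : p k + d k ≤ K.sup fun k => p k + d k :=
        Finset.le_sup (f := fun k => p k + d k) k.2
      by_cases hk : n - i < p k ∨ i < d k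
      · exact ⟨0, zero_mem _, by simp, by simp [hr0 k hk]⟩
      push Not at hk
      -- The product `g k * (t x ^ (i - d k))` has leading coefficient `coeff (d k) (g k) * σ ^ (d
      -- k) (t)` modulo higher powers, so `t` is a preimage of `r k` under `σ ^ (d k)`.
      obtain ⟨t, ht, htr⟩ := exists_mem_pow_iterate_eq hσ hσ' _ (d k) _ (hr k)
      have hm := monomial_mem_leadSubgroup (h := h) (j := i - d k) ht
      have e1 : p k + d k + (n - i - p k + (i - d k)) = n := by omega
      have e2 : d k + (i - d k) = i := by omega
      refine ⟨monomial h (i - d k) t,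
        totalFiltration_antitone (by omega) (leadSubgroup_le _ _ hm), ?_, ?_⟩
      · have := mul_mem_leadSubgroup hδ (hglead k) hm
        rwa [e1, e2] at this
      · have := coeff_mul_sub_mem hδ (hglead k) hm
        rwa [e1, e2, coeff_monomial_self, htr] at this
    choose s hs hsg hsc using hs
    have e3 : e (MulOpposite.op f - ∑ k, MulOpposite.op (s k) * MulOpposite.op (g k)) =
        f - ∑ k : K, g k * s k := by
      rw [map_sub, map_sum]
      rfl
    refine ⟨fun k => MulOpposite.op (s k), hs, ?_⟩
    rw [AddSubgroup.mem_comap, e3]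
    refine mem_leadSubgroup_of_succ (sub_mem hf (sum_mem fun k _ => hsg k)) ?_
    rw [show n - i + 1 = n + 1 - i by omega] at hra
    have h2 := sub_mem hra (sum_mem fun k (_ : k ∈ Finset.univ) => hsc k)
    rw [map_sub, map_sum]
    simp only [Finset.sum_sub_distrib] at h2
    convert h2 using 1
    abel
  have hge : Ideal.span (Set.range fun k : K => MulOpposite.op (g k)) ≤ L := by
    rw [Ideal.span_le]
    rintro _ ⟨k, rfl⟩
    exact hgL k
  rw [le_antisymm hle hge]
  exact Submodule.fg_span (Set.finite_range _)

end SkewPowerSeries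

/-! ### The case of the Jacobson radical -/

/-- A surjective ring homomorphism maps the Jacobson radical into the Jacobson radical; this is
applied to the inverse of `σ`. -/
lemma exists_mem_jacobson_map_eq {R : Type*} [Ring R] {σ : R →+* R} (hσ : Function.Bijective σ) :
    ∀ a ∈ Ring.jacobson R, ∃ b ∈ Ring.jacobson R, σ b = a := by
  intro a ha
  let τ := RingEquiv.ofBijective σ hσ
  have : RingHomSurjective (τ.symm : R →+* R) := ⟨τ.symm.surjective⟩
  exact ⟨τ.symm a, Ring.le_comap_jacobson (τ.symm : R →+* R) ha, τ.apply_symm_apply a⟩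

end SkewSeries

open SkewSeries in
theorem lemmaq2 {R : Type*} [Ring R] [IsLocalRing R] (σ : R →+* R) (δ : R →+ R)
    (hσ : Function.Bijective σ)
    (h : IsAdmissible (Ring.jacobson R) σ δ)
    (hδR : ∀ r : R, δ r ∈ Ring.jacobson R)
    (hδJ : ∀ a ∈ Ring.jacobson R, δ a ∈ Ring.jacobson R ^ 2) :
    (IsNoetherianRing (AssociatedGraded (Ring.jacobson R)) →
      IsNoetherianRing (SkewPowerSeries h)) ∧
    (IsNoetherianRing (AssociatedGraded (Ring.jacobson R))ᵐᵒᵖ →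
      IsNoetherianRing (SkewPowerSeries h)ᵐᵒᵖ) := by
  have hδ := derivation_pow_mem_succ h hδR hδJ
  have hJ := exists_mem_jacobson_map_eq hσ
  exact ⟨SkewPowerSeries.isNoetherianRing_of_associatedGraded hδ hJ hσ.surjective,
    SkewPowerSeries.isNoetherianRing_op_of_associatedGraded hδ hJ hσ.surjective⟩
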